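/- Let $\langle X\mid R\rangle$ be a finite presentation of a group $G$, with $X$ a finite set and $R$ a finite subset of the free group $F(X)$, and write $\|w\|$ for the length of the reduced form of $w\in F(X)$. Let $t=\max(\{\|r\| : r\in R\}\cup\{2\})$. For $g\in F(X)$ with $g=_G 1$, consider all expressions $$g=\prod_{j=1}^m w_jr_jw_j^{-1}\ \text{ in } F(X),\qquad m\ge 0,\ w_j\in F(X),\ r_j\in R\cup R^{-1}.$$ Let $\delta(g)$ be the smallest $m$ that occurs in such an expression, and let $\lambda(g)$ be the smallest value that $$m+\|w_1\|+\|w_m\|+\sum_{i=1}^{m-1}\|w_i^{-1}w_{i+1}\|$$ takes on such an expression (the value is $0$ for the empty expression, $m=0$). For an integer $n\ge 0$ let $$\Delta(n)=\max\{\delta(g) : g=_G1,\ \|g\|\le n\},\qquad \Lambda(n)=\max\{\lambda(g) : g=_G1,\ \|g\|\le n\};$$ thus $\Delta$ is the Dehn function of the presentation. Then for all $n\ge 0$, $$\Delta(n)\le\Lambda(n)\le 3t\,\Delta(n)^2 .$$ -/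

import Mathlib

namespace MillerMachine

variable {X : Type*}

/-- The product `∏ w_j r_j w_j⁻¹` attached to the list of pairs `(w_j, r_j)`. -/
def conjProd (L : List (FreeGroup X × FreeGroup X)) : FreeGroup X :=
  (L.map fun p => p.1 * p.2 * p.1⁻¹).prod

/-- The list of pairs `(w_j, r_j)` writes `g` as `∏ w_j r_j w_j⁻¹` in the free group on `X`,
with every `r_j` in `R ∪ R⁻¹`. The empty list writes the identity. -/
def Writes (R : Set (FreeGroup X)) (L : List (FreeGroup X × FreeGroup X)) (g : FreeGroup X) :
    Prop :=
  (∀ p ∈ L, p.2 ∈ R ∨ p.2⁻¹ ∈ R) ∧ conjProd L = g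

/-- `δ(g)`: the least number of factors in an expression `g = ∏ w_j r_j w_j⁻¹`. -/
noncomputable def area (R : Set (FreeGroup X)) (g : FreeGroup X) : ℕ :=
  sInf {m | ∃ L, Writes R L g ∧ L.length = m}

/-- Every element that is trivial in `⟨X | R⟩` can be written, so the minima are attained. -/
theorem exists_writes (R : Set (FreeGroup X)) {g : FreeGroup X}
    (hg : PresentedGroup.mk R g = 1) : ∃ L, Writes R L g := by
  have h : g ∈ Subgroup.normalClosure R := (QuotientGroup.eq_one_iff g).1 hg
  unfold Subgroup.normalClosure at h
  induction h using Subgroup.closure_induction with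
  | mem x hx =>
    obtain ⟨r, hr, hc⟩ := Group.mem_conjugatesOfSet_iff.1 hx
    obtain ⟨c, rfl⟩ := isConj_iff.1 hc
    exact ⟨[(c, r)], by simp [hr], by simp [conjProd]⟩
  | one => exact ⟨[], by simp, by simp [conjProd]⟩
  | mul x y hx hy ihx ihy =>
    obtain ⟨L, hL, rfl⟩ := ihx ((QuotientGroup.eq_one_iff x).2 hx)
    obtain ⟨M, hM, rfl⟩ := ihy ((QuotientGroup.eq_one_iff y).2 hy)
    refine ⟨L ++ M, fun p hp => ?_, by simp [conjProd]⟩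
    exact (List.mem_append.1 hp).elim (hL p) (hM p)
  | inv x hx ih =>
    obtain ⟨L, hL, rfl⟩ := ih ((QuotientGroup.eq_one_iff x).2 hx)
    refine ⟨(L.map fun p => (p.1, p.2⁻¹)).reverse, ?_, ?_⟩
    · intro p hp
      obtain ⟨q, hq, rfl⟩ := List.mem_map.1 (List.mem_reverse.1 hp)
      simpa [or_comm] using hL q hq
    · simp only [conjProd, List.prod_inv_reverse, List.map_map, List.map_reverse]
      congr 2
      apply List.map_congr_left
      intro p _
      simp [mul_assoc]

theorem exists_area (R : Set (FreeGroup X)) {g : FreeGroup X}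
    (hg : PresentedGroup.mk R g = 1) : ∃ L, Writes R L g ∧ L.length = area R g := by
  obtain ⟨L, hL⟩ := exists_writes R hg
  exact Nat.sInf_mem (s := {m | ∃ L, Writes R L g ∧ L.length = m}) ⟨_, L, hL, rfl⟩

variable [DecidableEq X]

/-- `f = m + ‖w_1‖ + ‖w_m‖ + ∑_{i=1}^{m-1} ‖w_i⁻¹ w_{i+1}‖` for the conjugators `w_1, …, w_m`
(it is `0` for `m = 0`). -/
def cost (ws : List (FreeGroup X)) : ℕ :=
  ws.length + (ws.headD 1).norm + (ws.getLastD 1).norm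
    + (List.zipWith (fun a b => (a⁻¹ * b).norm) ws ws.tail).sum

/-- `λ(g)`: the least value of `f` over all expressions `g = ∏ w_j r_j w_j⁻¹`. -/
noncomputable def lam (R : Set (FreeGroup X)) (g : FreeGroup X) : ℕ :=
  sInf {c | ∃ L, Writes R L g ∧ cost (L.map Prod.fst) = c}

/-- The elements `g` of the free group with `‖g‖ ≤ n` that are trivial in `G = ⟨X | R⟩`. -/
def nullBall (R : Set (FreeGroup X)) (n : ℕ) : Set (FreeGroup X) :=
  {g | g.norm ≤ n ∧ PresentedGroup.mk R g = 1}

/-- The Dehn function `Δ(n)` of the presentation `⟨X | R⟩`. -/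
noncomputable def dehn (R : Set (FreeGroup X)) (n : ℕ) : ℕ :=
  sSup (area R '' nullBall R n)

/-- The function `Λ(n)` of the presentation `⟨X | R⟩`. -/
noncomputable def Lam (R : Set (FreeGroup X)) (n : ℕ) : ℕ :=
  sSup (lam R '' nullBall R n)

/-- The maximal relator length `t = max ({‖r‖ : r ∈ R} ∪ {2})`. -/
def maxRelatorLength (R : Finset (FreeGroup X)) : ℕ :=
  max (R.sup FreeGroup.norm) 2

theorem exists_lam (R : Set (FreeGroup X)) {g : FreeGroup X}
    (hg : PresentedGroup.mk R g = 1) :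
    ∃ L, Writes R L g ∧ cost (L.map Prod.fst) = lam R g := by
  obtain ⟨L, hL⟩ := exists_writes R hg
  exact Nat.sInf_mem (s := {c | ∃ L, Writes R L g ∧ cost (L.map Prod.fst) = c}) ⟨_, L, hL, rfl⟩

theorem nullBall_finite [Finite X] (R : Set (FreeGroup X)) (n : ℕ) : (nullBall R n).Finite := by
  refine Set.Finite.of_finite_image (f := FreeGroup.toWord)
    ((List.finite_length_le (X × Bool) n).subset ?_) (FreeGroup.toWord_injective.injOn)
  rintro _ ⟨g, hg, rfl⟩
  exact hg.1

theorem nullBall_nonempty (R : Set (FreeGroup X)) (n : ℕ) : (nullBall R n).Nonempty :=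
  ⟨1, by simp [nullBall]⟩

/-- For finite `X` the maxima are attained. -/
theorem isGreatest_dehn [Finite X] (R : Set (FreeGroup X)) (n : ℕ) :
    IsGreatest (area R '' nullBall R n) (dehn R n) :=
  have hf := (nullBall_finite R n).image (area R)
  ⟨Nat.sSup_mem ((nullBall_nonempty R n).image _) hf.bddAbove,
    fun _ h => le_csSup hf.bddAbove h⟩

theorem isGreatest_Lam [Finite X] (R : Set (FreeGroup X)) (n : ℕ) :
    IsGreatest (lam R '' nullBall R n) (Lam R n) :=
  have hf := (nullBall_finite R n).image (lam R)
  ⟨Nat.sSup_mem ((nullBall_nonempty R n).image _) hf.bddAbove,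
    fun _ h => le_csSup hf.bddAbove h⟩

end MillerMachine

/-! The lower bound holds because `cost` counts the factors. For the upper bound, let `g` have area
at most `m` and length at most `n`, and peel a van Kampen diagram for `g` one boundary face at a
time. Replacing a boundary edge by the rest of its face lengthens the boundary by less than `t`. The
face can be split off at the left or at the right end of the product, so its conjugator only has to
reach it along the shorter side, about half the boundary (`AreaLE.exists_peel`). Since the boundary
has length at most `n + i t` after `i` peelings, summation gives `λ(g) ≤ m (n + 1) + t m (m + 1) /
2` (`lam_le_of_area_le`). Planar topology is avoided: diagrams are encoded by the recursive
predicate `Nest` on cyclic words, which survives concatenation and free reduction (`Nest.append`,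
`Nest.red`).

It remains to bound `n` by `D = Δ(n)` (`succ_le_two_mul_dehn`). If a nontrivial relation of length
at most `n` exists, a shortest one `r` crosses no edge of the Cayley graph in both directions, so
some edge potential with values `±1` sums to `‖r‖` along `r`, hence to `k ‖r‖` along `r ^ k`. A
conjugate of a relator contributes at most `t`, so `k ‖r‖ ≤ t D` for `k = ⌊n / ‖r‖⌋ ≥ 1`, and `n + 1
≤ (k + 1) ‖r‖ ≤ 2 k ‖r‖ ≤ 2 t D`. Then `2 λ(g) ≤ 4 t D² + t D + t D² ≤ 6 t D²`. If no such relation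
exists, only `g = 1` occurs and `Λ(n) = 0`. -/

namespace MillerMachine

open FreeGroup hiding map_mul map_inv map_one
open List

/-! ### Area bounds, and diagrams encoded as nested cyclic words -/

section Nesting

variable {X : Type*}

/-- `g` is a product of at most `m` conjugates of elements of `R ∪ R⁻¹`. -/
def AreaLE (R : Set (FreeGroup X)) (m : ℕ) (g : FreeGroup X) : Prop :=
  ∃ L, Writes R L g ∧ L.length ≤ m

theorem AreaLE.mono {R : Set (FreeGroup X)} {m n : ℕ} {g : FreeGroup X} (h : AreaLE R m g)
    (hmn : m ≤ n) : AreaLE R n g :=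
  let ⟨L, hL, hm⟩ := h
  ⟨L, hL, hm.trans hmn⟩

theorem areaLE_area {R : Set (FreeGroup X)} {g : FreeGroup X}
    (hg : PresentedGroup.mk R g = 1) : AreaLE R (area R g) g :=
  let ⟨L, hL, hm⟩ := exists_area R hg
  ⟨L, hL, hm.le⟩

theorem areaLE_one (R : Set (FreeGroup X)) (m : ℕ) : AreaLE R m 1 :=
  ⟨[], by simp [Writes, conjProd], by simp⟩

theorem Writes.append {R : Set (FreeGroup X)} {L M : List (FreeGroup X × FreeGroup X)}
    {g h : FreeGroup X} (hL : Writes R L g) (hM : Writes R M h) : Writes R (L ++ M) (g * h) := by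
  refine ⟨fun p hp => (List.mem_append.1 hp).elim (hL.1 p) (hM.1 p), ?_⟩
  rw [← hL.2, ← hM.2]
  simp [conjProd]

theorem writes_singleton {R : Set (FreeGroup X)} {r : FreeGroup X} (hr : r ∈ R ∨ r⁻¹ ∈ R)
    (w : FreeGroup X) : Writes R [(w, r)] (w * r * w⁻¹) :=
  ⟨by simpa using hr, by simp [conjProd]⟩

theorem AreaLE.mul {R : Set (FreeGroup X)} {m n : ℕ} {g h : FreeGroup X} (hg : AreaLE R m g)
    (hh : AreaLE R n h) : AreaLE R (m + n) (g * h) := by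
  obtain ⟨L, hL, hm⟩ := hg
  obtain ⟨M, hM, hn⟩ := hh
  exact ⟨L ++ M, hL.append hM, by simp; omega⟩

theorem AreaLE.conj {R : Set (FreeGroup X)} {m : ℕ} {g : FreeGroup X} (hg : AreaLE R m g)
    (c : FreeGroup X) : AreaLE R m (c * g * c⁻¹) := by
  obtain ⟨L, ⟨hL, rfl⟩, hm⟩ := hg
  refine ⟨L.map fun p => (c * p.1, p.2), ⟨?_, ?_⟩, by simpa using hm⟩
  · intro p hp
    obtain ⟨q, hq, rfl⟩ := List.mem_map.1 hp
    exact hL q hq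
  · clear hL hm
    induction L with
    | nil => simp [conjProd]
    | cons p L ih =>
      simp only [conjProd, List.map_cons, List.prod_cons] at ih ⊢
      rw [ih]
      group

theorem AreaLE.insert {R : Set (FreeGroup X)} {m n : ℕ} {a b h : FreeGroup X}
    (hg : AreaLE R m (a * b)) (hh : AreaLE R n h) : AreaLE R (m + n) (a * h * b) := by
  have := (hh.conj a).mul hg
  rw [add_comm] at this
  convert this using 1
  group

theorem areaLE_conj_mem {R : Set (FreeGroup X)} {r : FreeGroup X} (hr : r ∈ R ∨ r⁻¹ ∈ R)
    (w : FreeGroup X) : AreaLE R 1 (w * r * w⁻¹) :=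
  ⟨[(w, r)], writes_singleton hr w, by simp⟩

/-- The inverse letter. -/
def invLetter (e : X × Bool) : X × Bool := (e.1, !e.2)

theorem invLetter_invLetter (e : X × Bool) : invLetter (invLetter e) = e := by simp [invLetter]

theorem mk_cons (e : X × Bool) (w : List (X × Bool)) : mk (e :: w) = mk [e] * mk w := by
  simp [mul_mk]

theorem mk_invLetter (e : X × Bool) : mk [invLetter e] = (mk [e])⁻¹ := by
  simp [inv_mk, invRev, invLetter]

variable [DecidableEq X]

/-- `z` is a conjugate of an element of `R ∪ R⁻¹` by an element of length at most `t / 2`. -/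
def IsShortConj (R : Set (FreeGroup X)) (t : ℕ) (z : FreeGroup X) : Prop :=
  ∃ c r, 2 * c.norm ≤ t ∧ (r ∈ R ∨ r⁻¹ ∈ R) ∧ z = c * r * c⁻¹

theorem IsShortConj.areaLE {R : Set (FreeGroup X)} {t : ℕ} {z : FreeGroup X}
    (h : IsShortConj R t z) : AreaLE R 1 z := by
  obtain ⟨c, r, -, hr, rfl⟩ := h
  exact areaLE_conj_mem hr c

/-- The first letter of `e h` lies on a relator `e s`, and replacing `e` by `s⁻¹` lowers the
area bound `m`. -/
def OnFace (R : Set (FreeGroup X)) (t : ℕ) (e : X × Bool) (h : FreeGroup X) (m : ℕ) : Prop :=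
  ∃ s k, s.norm + 1 ≤ t ∧ IsShortConj R t (mk [e] * s) ∧ IsShortConj R t (s * mk [e]) ∧
    k + 1 ≤ m ∧ AreaLE R k (s⁻¹ * h)

/-- A cyclic word bounds a planar diagram with at most `m` faces: every letter lies on a face or
is glued to an inverse letter, and then the two words in between bound diagrams again. -/
def Nest (R : Set (FreeGroup X)) (t : ℕ) (w : List (X × Bool)) (m : ℕ) : Prop :=
  ∀ e v, ∀ _ : (e :: v) ~r w, OnFace R t e (mk v) m ∨
    ∃ p q a b, ∃ _ : v = p ++ invLetter e :: q, a + b ≤ m ∧ Nest R t p a ∧ Nest R t q b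
termination_by w.length
decreasing_by
  all_goals
    have h1 := (‹(e :: v) ~r w›).perm.length_eq
    have h2 := congrArg List.length ‹v = p ++ invLetter e :: q›
    simp at h1 h2
    omega
end Nesting

/-! ### Gluing and free reduction of diagrams -/

section NestingLemmas

variable {X : Type*} [DecidableEq X] {R : Set (FreeGroup X)} {t : ℕ}

theorem OnFace.of_eq {e : X × Bool} {h h' : FreeGroup X} {m : ℕ} (H : OnFace R t e h m)
    (hh : h = h') : OnFace R t e h' m :=
  hh ▸ H

theorem OnFace.insert {e : X × Bool} {a b h : FreeGroup X} {m n : ℕ}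
    (H : OnFace R t e (a * b) m) (hh : AreaLE R n h) : OnFace R t e (a * h * b) (m + n) := by
  obtain ⟨s, k, hs, h1, h2, hk, hA⟩ := H
  refine ⟨s, k + n, hs, h1, h2, by omega, ?_⟩
  rw [← mul_assoc] at hA
  have := hA.insert hh
  simpa [mul_assoc] using this

theorem OnFace.areaLE {e : X × Bool} {h : FreeGroup X} {m : ℕ} (H : OnFace R t e h m) :
    AreaLE R m (mk [e] * h) := by
  obtain ⟨s, k, -, h1, -, hk, hA⟩ := H
  have := h1.areaLE.mul hA
  refine AreaLE.mono (m := 1 + k) ?_ (by omega)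
  convert this using 1
  group

theorem exists_append_of_isRotated_cons {α : Type*} {e : α} {v w : List α}
    (h : (e :: v) ~r w) : ∃ u v', w = u ++ e :: v' ∧ v = v' ++ u := by
  obtain ⟨n, hn, rfl⟩ := List.isRotated_iff_mod.1 h
  rcases n with _ | n
  · exact ⟨[], v, by simp, by simp⟩
  · rw [List.rotate_eq_drop_append_take hn]
    exact ⟨v.drop n, v.take n, by simp, by simp⟩

theorem Nest.rotate {w w' : List (X × Bool)} {m : ℕ} (h : Nest R t w m) (hw : w ~r w') :
    Nest R t w' m := by
  rw [Nest] at h ⊢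
  exact fun e v hv => h e v (hv.trans hw.symm)

theorem Nest.comm {w w' : List (X × Bool)} {m : ℕ} (h : Nest R t (w ++ w') m) :
    Nest R t (w' ++ w) m :=
  h.rotate List.isRotated_append

theorem Nest.head {e : X × Bool} {v : List (X × Bool)} {m : ℕ} (h : Nest R t (e :: v) m) :
    OnFace R t e (mk v) m ∨
      ∃ p q a b, v = p ++ invLetter e :: q ∧ a + b ≤ m ∧ Nest R t p a ∧ Nest R t q b := by
  rw [Nest] at h
  obtain h | ⟨p, q, a, b, h, h'⟩ := h e v (.refl _)
  exacts [.inl h, .inr ⟨p, q, a, b, h, h'⟩]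

theorem nest_of_head {w : List (X × Bool)} {m : ℕ}
    (h : ∀ u e v, w = u ++ e :: v → OnFace R t e (mk (v ++ u)) m ∨
      ∃ p q a b, v ++ u = p ++ invLetter e :: q ∧ a + b ≤ m ∧ Nest R t p a ∧ Nest R t q b) :
    Nest R t w m := by
  rw [Nest]
  intro e v hv
  obtain ⟨u, v', rfl, rfl⟩ := exists_append_of_isRotated_cons hv
  obtain h | ⟨p, q, a, b, h, h'⟩ := h u e v' rfl
  exacts [.inl h, .inr ⟨p, q, a, b, h, h'⟩]

theorem nest_nil (m : ℕ) : Nest R t [] m :=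
  nest_of_head (by simp)

theorem Nest.mono {w : List (X × Bool)} {m n : ℕ} (h : Nest R t w m) (hmn : m ≤ n) :
    Nest R t w n := by
  refine nest_of_head fun u e v hw => ?_
  subst hw
  obtain ⟨s, k, hs, h1, h2, hk, hA⟩ | ⟨p, q, a, b, hv, hab, hp, hq⟩ := h.comm.head
  · exact .inl ⟨s, k, hs, h1, h2, hk.trans hmn, hA⟩
  · exact .inr ⟨p, q, a, b, hv, hab.trans hmn, hp, hq⟩

theorem Nest.areaLE {w : List (X × Bool)} {m : ℕ} (h : Nest R t w m) : AreaLE R m (mk w) := by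
  induction hl : w.length using Nat.strong_induction_on generalizing w m with
  | _ l ih =>
    rcases w with _ | ⟨e, v⟩
    · exact areaLE_one R m
    obtain h | ⟨p, q, a, b, rfl, hab, hp, hq⟩ := h.head
    · rw [mk_cons]
      exact h.areaLE
    · simp only [List.length_cons, List.length_append] at hl
      have h1 := ih p.length (by omega) hp rfl
      have h2 := ih q.length (by omega) hq rfl
      refine AreaLE.mono ((h1.conj (mk [e])).mul h2) hab |> fun h => ?_
      rw [mk_cons, ← mul_mk, mk_cons (invLetter e), mk_invLetter]
      simpa only [mul_assoc] using h

/-- Two diagrams are glued at a vertex. A letter keeps its face or its partner, and the other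
diagram is absorbed by the remainder of that face or by one of the two words that the partner cuts
off. The latter absorption is a shorter instance of the same statement, whence the induction on
total length. -/
theorem Nest.append {w w' : List (X × Bool)} {m n : ℕ} (h : Nest R t w m) (h' : Nest R t w' n) :
    Nest R t (w ++ w') (m + n) := by
  induction hl : (w ++ w').length using Nat.strong_induction_on generalizing w w' m n with
  | _ l ih =>
    have insert : ∀ {x z y : List (X × Bool)} {i j : ℕ}, Nest R t (x ++ z) i → Nest R t y j →
        (x ++ y ++ z).length < l → Nest R t (x ++ y ++ z) (i + j) := by
      intro x z y i j hxz hy hlt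
      simp only [List.length_append] at hlt
      have := ih _ (by simp; omega) hxz.comm hy rfl
      rw [List.append_assoc] at this
      exact this.comm
    have key : ∀ {e : X × Bool} {x z y : List (X × Bool)} {i j : ℕ},
        Nest R t (e :: (x ++ z)) i → Nest R t y j → (e :: (x ++ y ++ z)).length = l →
        OnFace R t e (mk (x ++ y ++ z)) (i + j) ∨ ∃ p q a b, x ++ y ++ z = p ++ invLetter e :: q ∧
          a + b ≤ i + j ∧ Nest R t p a ∧ Nest R t q b := by
      intro e x z y i j hxz hy hlen
      simp only [List.length_cons, List.length_append] at hlen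
      obtain hf | ⟨p, q, a, b, hv, hab, hp, hq⟩ := hxz.head
      · left
        rw [← mul_mk] at hf
        simpa [mul_mk] using hf.insert hy.areaLE
      · right
        have hvl := congrArg List.length hv
        simp only [List.length_cons, List.length_append] at hvl
        obtain ⟨c, rfl, rfl⟩ | ⟨c, rfl, hc⟩ := List.append_eq_append_iff.1 hv
        · refine ⟨x ++ y ++ c, q, a + j, b, by simp, by omega, insert hp hy ?_, hq⟩
          simp only [List.length_append, List.length_cons] at hlen hvl ⊢
          omega
        · rcases c with _ | ⟨d, c⟩
          · simp only [List.nil_append] at hc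
            subst hc
            refine ⟨p ++ y, q, a + j, b, by simp, by omega, ?_, hq⟩
            exact ih _ (by simp; omega) hp hy rfl
          · obtain ⟨rfl, rfl⟩ := List.cons_eq_cons.1 hc
            refine ⟨p, c ++ y ++ z, a, b + j, by simp, by omega, hp, insert hq hy ?_⟩
            simp only [List.length_append, List.length_cons] at hlen hvl ⊢
            omega
    refine nest_of_head fun u e v hw => ?_
    obtain ⟨c, rfl, rfl⟩ | ⟨c, rfl, hc⟩ := List.append_eq_append_iff.1 hw
    · have := key (e := e) (x := v) (z := c) (y := w) (i := n) (j := m) h'.comm h (by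
        simp only [List.length_append, List.length_cons] at hl ⊢
        omega)
      simpa [add_comm] using this
    · rcases c with _ | ⟨d, c⟩
      · simp only [List.nil_append] at hc
        subst hc
        have := key (e := e) (x := v) (z := []) (y := u) (i := n) (j := m) (by simpa using h')
          (by simpa using h) (by
          simp only [List.length_append, List.length_cons, List.length_nil] at hl ⊢
          omega)
        simpa [add_comm] using this
      · obtain ⟨rfl, rfl⟩ := List.cons_eq_cons.1 hc
        have := key (e := e) (x := c) (z := u) (y := w') (i := m) (j := n) h.comm h' (by
          simp only [List.length_append, List.length_cons] at hl ⊢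
          omega)
        simpa using this

theorem Nest.insert {x y z : List (X × Bool)} {m n : ℕ} (h : Nest R t (x ++ z) m)
    (h' : Nest R t y n) : Nest R t (x ++ y ++ z) (m + n) := by
  have := h.comm.append h'
  rw [List.append_assoc] at this
  exact this.comm

theorem nest_cancel_pair (e : X × Bool) : Nest R t [e, invLetter e] 0 := by
  refine nest_of_head fun u d v hw => .inr ?_
  rcases u with _ | ⟨a, _ | ⟨b, u⟩⟩
  · simp only [List.nil_append, List.cons.injEq] at hw
    obtain ⟨rfl, rfl⟩ := hw
    exact ⟨[], [], 0, 0, by simp, le_rfl, nest_nil 0, nest_nil 0⟩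
  · simp only [List.cons_append, List.nil_append, List.cons.injEq] at hw
    obtain ⟨rfl, rfl, rfl⟩ := hw
    exact ⟨[], [], 0, 0, by simp [invLetter_invLetter], le_rfl, nest_nil 0, nest_nil 0⟩
  · simp at hw

theorem Nest.conj_letter {w : List (X × Bool)} {m : ℕ} (h : Nest R t w m) (e : X × Bool) :
    Nest R t (e :: (w ++ [invLetter e])) m := by
  have := Nest.insert (x := [e]) (z := [invLetter e]) (nest_cancel_pair e) h
  simpa using this

theorem Nest.conj {w : List (X × Bool)} {m : ℕ} (h : Nest R t w m) (c : List (X × Bool)) :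
    Nest R t (c ++ w ++ invRev c) m := by
  induction c with
  | nil => simpa using h
  | cons e c ih =>
    rw [invRev_cons]
    simpa [invRev, invLetter] using ih.conj_letter e

/-- Two adjacent boundary edges are folded together. If a letter `d` was glued to one of them, the
other is a copy of `d` and takes its place; otherwise the pair lies inside one of the two smaller
words and is cancelled there by induction. -/
theorem Nest.cancel {e : X × Bool} {w : List (X × Bool)} {m : ℕ}
    (h : Nest R t (e :: invLetter e :: w) m) : Nest R t w m := by
  induction hl : w.length using Nat.strong_induction_on generalizing e w m with
  | _ l ih =>
    have cancel : ∀ {f : X × Bool} {x z : List (X × Bool)} {i : ℕ},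
        Nest R t (x ++ f :: invLetter f :: z) i → (x ++ z).length < l → Nest R t (x ++ z) i := by
      intro f x z i hx hlt
      have h1 := ih (z ++ x).length (by simpa [add_comm] using hlt)
        (Nest.comm (w := x) (w' := f :: invLetter f :: z) hx) rfl
      exact h1.comm
    refine nest_of_head fun u d v hw => ?_
    subst hw
    have h1 : Nest R t (d :: (v ++ e :: invLetter e :: u)) m :=
      Nest.comm (w := e :: invLetter e :: u) (w' := d :: v) h
    simp only [List.length_append, List.length_cons] at hl
    obtain hf | ⟨p, q, a, b, hv, hab, hp, hq⟩ := h1.head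
    · left
      refine hf.of_eq ?_
      rw [← mul_mk, ← mul_mk, mk_cons, mk_cons (invLetter e), mk_invLetter]
      group
    have hvl := congrArg List.length hv
    simp only [List.length_cons, List.length_append] at hvl
    obtain ⟨c, rfl, hc⟩ | ⟨c, rfl, hc⟩ := List.append_eq_append_iff.1 hv
    · rcases c with _ | ⟨c1, _ | ⟨c2, c⟩⟩
      · simp only [List.nil_append, List.cons.injEq] at hc
        obtain ⟨rfl, rfl⟩ := hc
        rw [invLetter_invLetter] at hq
        simp only [List.append_nil] at hp
        exact ((Nest.insert (x := [d]) (z := u) hq hp).mono (by omega)).head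
      · simp only [List.cons_append, List.nil_append, List.cons.injEq] at hc
        obtain ⟨rfl, hde, rfl⟩ := hc
        obtain rfl : e = d := by rw [← invLetter_invLetter e, hde, invLetter_invLetter]
        exact ((hp.comm.append hq).mono hab).head
      · simp only [List.cons_append, List.cons.injEq] at hc
        obtain ⟨rfl, rfl, rfl⟩ := hc
        exact .inr ⟨v ++ c, q, a, b, by simp, hab, cancel hp (by simp at hl ⊢; omega), hq⟩
    · rcases c with _ | ⟨d, c⟩
      · simp only [List.nil_append, List.cons.injEq] at hc
        obtain ⟨rfl, rfl⟩ := hc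
        rw [invLetter_invLetter] at hq
        exact ((Nest.insert (x := [d]) (z := u) hq (by simpa using hp)).mono (by omega)).head
      · simp only [List.cons_append, List.cons.injEq] at hc
        obtain ⟨rfl, rfl⟩ := hc
        exact .inr ⟨p, c ++ u, a, b, by simp, hab, hp, cancel hq (by simp at hl ⊢; omega)⟩

theorem Nest.red {w w' : List (X × Bool)} {m : ℕ} (h : Nest R t w m) (hw : Red w w') :
    Nest R t w' m := by
  induction hw with
  | refl => exact h
  | tail _ hs ih =>
    obtain ⟨⟩ := hs
    exact ih.comm.cancel.comm

/-- The rotation is conjugation by `a⁻¹` and equally by `b`; the shorter of the two has length at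
most `t / 2`. -/
theorem isShortConj_rotate {r : FreeGroup X} {a b : List (X × Bool)} (hr : r ∈ R ∨ r⁻¹ ∈ R)
    (hab : r = mk (a ++ b)) (ht : a.length + b.length ≤ t) : IsShortConj R t (mk (b ++ a)) := by
  have ha := norm_mk_le (L₁ := a)
  have hb := norm_mk_le (L₁ := b)
  rcases le_total a.length b.length with h | h
  · refine ⟨(mk a)⁻¹, r, by rw [norm_inv_eq]; omega, hr, ?_⟩
    rw [hab, ← mul_mk, ← mul_mk]
    group
  · refine ⟨mk b, r, by omega, hr, ?_⟩
    rw [hab, ← mul_mk, ← mul_mk]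
    group

theorem nest_relator {r : FreeGroup X} (hr : r ∈ R ∨ r⁻¹ ∈ R) (ht : r.norm ≤ t) :
    Nest R t r.toWord 1 := by
  refine nest_of_head fun u e v hw => .inl ⟨mk (v ++ u), 0, ?_, ?_, ?_, le_rfl, ?_⟩
  · have h1 := norm_mk_le (L₁ := v ++ u)
    rw [FreeGroup.norm, hw] at ht
    simp only [List.length_append, List.length_cons] at h1 ht
    omega
  · rw [FreeGroup.norm, hw, List.length_append] at ht
    rw [← mk_cons]
    exact isShortConj_rotate (a := u) (b := e :: v) hr (by rw [← hw, mk_toWord]) ht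
  · rw [FreeGroup.norm, hw] at ht
    rw [mul_mk]
    have := isShortConj_rotate (R := R) (t := t) (a := u ++ [e]) (b := v) hr
      (by rw [List.append_assoc, List.singleton_append, ← hw, mk_toWord])
      (by simp at ht ⊢; omega)
    simpa using this
  · rw [inv_mul_cancel]
    exact areaLE_one R 0

/-- A product of conjugates bounds a bouquet of relator faces on stems; its boundary word is then
freely reduced. -/
theorem AreaLE.nest {m : ℕ} {g : FreeGroup X} (h : AreaLE R m g)
    (ht : ∀ r ∈ R, r.norm ≤ t) : Nest R t g.toWord m := by
  obtain ⟨L, ⟨hL, rfl⟩, hm⟩ := h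
  refine Nest.mono ?_ hm
  clear hm
  induction L with
  | nil => simpa [conjProd] using nest_nil 0
  | cons p L ih =>
    have hp : Nest R t p.2.toWord 1 := by
      have := hL p (by simp)
      refine nest_relator this ?_
      rcases this with h | h
      · exact ht _ h
      · rw [← norm_inv_eq]
        exact ht _ h
    have h1 := (hp.conj p.1.toWord).append (ih fun q hq => hL q (by simp [hq]))
    rw [List.length_cons, add_comm]
    refine h1.red ?_
    have h2 : conjProd (p :: L) =
        mk (p.1.toWord ++ p.2.toWord ++ invRev p.1.toWord ++ (conjProd L).toWord) := by
      simp only [← mul_mk, ← inv_mk, mk_toWord]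
      simp [conjProd]
    rw [h2, toWord_mk]
    exact reduce.red

/-- A nonempty reduced word that bounds a diagram has a letter on a face. -/
theorem Nest.exists_face {w : List (X × Bool)} {m : ℕ} (h : Nest R t w m) (hw : IsReduced w)
    (hne : w ≠ []) : ∃ u e v s k, w = u ++ e :: v ∧ s.norm + 1 ≤ t ∧
      IsShortConj R t (mk [e] * s) ∧ IsShortConj R t (s * mk [e]) ∧ k + 1 ≤ m ∧
      AreaLE R k (mk u * s⁻¹ * mk v) := by
  induction hl : w.length using Nat.strong_induction_on generalizing w m with
  | _ l ih =>
    rcases w with _ | ⟨e, v⟩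
    · exact absurd rfl hne
    obtain ⟨s, k, hs, h1, h2, hk, hA⟩ | ⟨p, q, a, b, rfl, hab, hp, hq⟩ := h.head
    · exact ⟨[], e, v, s, k, rfl, hs, h1, h2, hk, by simpa [← one_eq_mk] using hA⟩
    · have hp0 : p ≠ [] := by
        rintro rfl
        have := (isReduced_cons_cons.1 hw).1 rfl
        simp [invLetter] at this
      obtain ⟨u, f, v, s, k, rfl, hs, h1, h2, hk, hA⟩ := ih p.length
        (by simp at hl; omega) hp (hw.infix ⟨[e], invLetter e :: q, by simp⟩) hp0 rfl
      refine ⟨e :: u, f, v ++ invLetter e :: q, s, k + b, by simp, hs, h1, h2, by omega, ?_⟩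
      have := (hA.conj (mk [e])).mul hq.areaLE
      rw [mk_cons, ← mul_mk, mk_cons (invLetter e), mk_invLetter]
      simpa only [mul_assoc] using this

end NestingLemmas

/-! ### Peeling off faces and the quadratic bound -/

section Peeling

variable {X : Type*} [DecidableEq X] {R : Set (FreeGroup X)} {t : ℕ}

/-- A relator with a short conjugator can be split off from either end of `g`, so that the rest
has smaller area and is not much longer than `g`. -/
theorem AreaLE.exists_peel {m : ℕ} {g : FreeGroup X} (h : AreaLE R (m + 1) g)
    (ht : ∀ r ∈ R, r.norm ≤ t) (hg : g ≠ 1) :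
    ∃ w r g', (r ∈ R ∨ r⁻¹ ∈ R) ∧ 2 * w.norm ≤ g.norm + t ∧ g'.norm ≤ g.norm + t ∧
      AreaLE R m g' ∧ (g = w * r * w⁻¹ * g' ∨ g = g' * (w * r * w⁻¹)) := by
  obtain ⟨u, e, v, s, k, hw, hs, ⟨c, r, hc, hr, h1⟩, ⟨d, r', hd, hr', h2⟩, hk, hA⟩ :=
    (h.nest ht).exists_face isReduced_toWord (by simpa using hg)
  have hlen : g.norm = u.length + v.length + 1 := by
    rw [FreeGroup.norm, hw, List.length_append, List.length_cons]
    omega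
  have hg' : g = mk u * mk [e] * mk v := by
    rw [mul_assoc, ← mk_cons, mul_mk, ← hw, mk_toWord]
  have hu := norm_mk_le (L₁ := u)
  have hv := norm_mk_le (L₁ := v)
  have hn : (mk u * s⁻¹ * mk v).norm ≤ g.norm + t := by
    have h3 := norm_mul_le (mk u * s⁻¹) (mk v)
    have h4 := norm_mul_le (mk u) s⁻¹
    rw [norm_inv_eq] at h4
    omega
  have hA' := hA.mono (n := m) (by omega)
  rcases le_total u.length v.length with huv | huv
  · refine ⟨mk u * c, r, mk u * s⁻¹ * mk v, hr, ?_, hn, hA', .inl ?_⟩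
    · have := norm_mul_le (mk u) c
      omega
    · have : mk u * c * r * (mk u * c)⁻¹ = mk u * (c * r * c⁻¹) * (mk u)⁻¹ := by group
      rw [this, ← h1, hg']
      group
  · refine ⟨(mk v)⁻¹ * d, r', mk u * s⁻¹ * mk v, hr', ?_, hn, hA', .inr ?_⟩
    · have := norm_mul_le (mk v)⁻¹ d
      rw [norm_inv_eq] at this
      omega
    · have : (mk v)⁻¹ * d * r' * ((mk v)⁻¹ * d)⁻¹ = (mk v)⁻¹ * (d * r' * d⁻¹) * mk v := by group
      rw [this, ← h2, hg']
      group

theorem AreaLE.exists_writes_le {m n : ℕ} {g : FreeGroup X} (h : AreaLE R m g)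
    (ht : ∀ r ∈ R, r.norm ≤ t) (hn : g.norm ≤ n) :
    ∃ L, Writes R L g ∧
      2 * (L.map fun p => 1 + 2 * p.1.norm).sum ≤ 2 * m * (n + 1) + t * m + t * m ^ 2 := by
  induction m generalizing g n with
  | zero =>
    obtain ⟨L, hL, hm⟩ := h
    obtain rfl : L = [] := by simpa using hm
    exact ⟨[], hL, by simp⟩
  | succ m ih =>
    by_cases hg : g = 1
    · subst hg
      exact ⟨[], by simp [Writes, conjProd], by simp⟩
    obtain ⟨w, r, g', hr, hw, hg', hA, h1⟩ := h.exists_peel ht hg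
    -- The bound solves this recursion exactly: its value at `(m + 1, n)` is its value at `(m, n +
    -- t)` plus `2 (1 + n + t)`.
    obtain ⟨L, hL, hs⟩ := ih (n := n + t) hA (hg'.trans (by omega))
    have hs' : 2 * (1 + 2 * w.norm + (L.map fun p => 1 + 2 * p.1.norm).sum) ≤
        2 * (m + 1) * (n + 1) + t * (m + 1) + t * (m + 1) ^ 2 := by
      nlinarith
    rcases h1 with rfl | rfl
    · exact ⟨(w, r) :: L, (writes_singleton hr w).append hL, by simpa using hs'⟩
    · exact ⟨L ++ [(w, r)], hL.append (writes_singleton hr w), by simpa [add_comm] using hs'⟩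

theorem cost_cons_le (a : FreeGroup X) (ws : List (FreeGroup X)) :
    (List.zipWith (fun a b => (a⁻¹ * b).norm) (a :: ws) ws).sum + (ws.getLastD a).norm ≤
      a.norm + 2 * (ws.map FreeGroup.norm).sum := by
  induction ws generalizing a with
  | nil => simp
  | cons b ws ih =>
    have h1 := ih b
    have h2 := norm_mul_le a⁻¹ b
    rw [norm_inv_eq] at h2
    simp only [List.zipWith_cons_cons, List.sum_cons, List.map_cons, List.getLastD_cons]
    omega

/-- With the two end terms included, each conjugator enters exactly two norms; the triangle
inequality separates them. -/
theorem cost_le (ws : List (FreeGroup X)) :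
    cost ws ≤ (ws.map fun w => 1 + 2 * w.norm).sum := by
  have hsum : ∀ l : List (FreeGroup X), (l.map fun w => 1 + 2 * w.norm).sum =
      l.length + 2 * (l.map FreeGroup.norm).sum := by
    intro l
    induction l with
    | nil => simp
    | cons a l ih => simp [ih]; ring
  rw [hsum]
  rcases ws with _ | ⟨a, ws⟩
  · simp [cost]
  · have := cost_cons_le a ws
    simp only [cost, List.headD_cons, List.getLastD_cons, List.tail_cons, List.map_cons,
      List.sum_cons]
    omega

theorem lam_le_of_area_le {m n : ℕ} {g : FreeGroup X} (h : AreaLE R m g)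
    (ht : ∀ r ∈ R, r.norm ≤ t) (hn : g.norm ≤ n) :
    2 * lam R g ≤ 2 * m * (n + 1) + t * m + t * m ^ 2 := by
  obtain ⟨L, hL, hs⟩ := h.exists_writes_le ht hn
  have h1 : lam R g ≤ cost (L.map Prod.fst) := Nat.sInf_le ⟨L, hL, rfl⟩
  have h2 := cost_le (L.map Prod.fst)
  rw [List.map_map] at h2
  have h3 : lam R g ≤ (L.map fun p => 1 + 2 * p.1.norm).sum := h1.trans h2
  omega

theorem area_le_lam {g : FreeGroup X} (hg : PresentedGroup.mk R g = 1) : area R g ≤ lam R g := by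
  obtain ⟨L, hL, hc⟩ := exists_lam R hg
  have h1 : area R g ≤ L.length := Nat.sInf_le ⟨L, hL, rfl⟩
  rw [← hc]
  refine h1.trans ?_
  simp only [cost, List.length_map]
  omega

end Peeling

/-! ### Edge potentials on the Cayley graph -/

section EdgePotential

variable {X : Type*} (R : Set (FreeGroup X)) (φ : X → PresentedGroup R → ℤ)

/-- Crossing the edge labelled `x` of the Cayley graph, which adds its potential. -/
def crossEdge (x : X) : Equiv.Perm (PresentedGroup R × ℤ) where
  toFun p := (PresentedGroup.mk R (of x) * p.1, p.2 + φ x p.1)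
  invFun p := ((PresentedGroup.mk R (of x))⁻¹ * p.1,
    p.2 - φ x ((PresentedGroup.mk R (of x))⁻¹ * p.1))
  left_inv p := by simp
  right_inv p := by simp

/-- The action of the free group that sums the potential along paths in the Cayley graph. -/
def crossPath : FreeGroup X →* Equiv.Perm (PresentedGroup R × ℤ) :=
  FreeGroup.lift (crossEdge R φ)

/-- The sum of the potential along the path from `h` to `g h`, read off `g` from the right. -/
def pathSum (g : FreeGroup X) (h : PresentedGroup R) : ℤ :=
  (crossPath R φ g (h, 0)).2

theorem crossPath_apply (g : FreeGroup X) (h : PresentedGroup R) (c : ℤ) :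
    crossPath R φ g (h, c) = (PresentedGroup.mk R g * h, c + pathSum R φ g h) := by
  suffices H : ∃ f : PresentedGroup R → ℤ, ∀ h c,
      crossPath R φ g (h, c) = (PresentedGroup.mk R g * h, c + f h) by
    obtain ⟨f, hf⟩ := H
    simp [pathSum, hf]
  clear h c
  induction g using FreeGroup.induction_on with
  | C1 => exact ⟨0, by simp⟩
  | of x => exact ⟨φ x, by simp [crossPath, crossEdge]⟩
  | inv_of x _ =>
    refine ⟨fun h => -φ x ((PresentedGroup.mk R (of x))⁻¹ * h), fun h c => ?_⟩
    rw [map_inv, Equiv.Perm.inv_def, crossPath, lift_apply_of]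
    simp [crossEdge, sub_eq_add_neg]
  | mul a b iha ihb =>
    obtain ⟨f, hf⟩ := iha
    obtain ⟨f', hf'⟩ := ihb
    refine ⟨fun h => f' h + f (PresentedGroup.mk R b * h), fun h c => ?_⟩
    rw [map_mul, Equiv.Perm.mul_apply, hf', hf, map_mul, mul_assoc, add_assoc]

theorem pathSum_one (h : PresentedGroup R) : pathSum R φ 1 h = 0 := by
  simp [pathSum]

theorem pathSum_mul (a b : FreeGroup X) (h : PresentedGroup R) :
    pathSum R φ (a * b) h = pathSum R φ b h + pathSum R φ a (PresentedGroup.mk R b * h) := by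
  rw [pathSum, map_mul, Equiv.Perm.mul_apply, crossPath_apply, crossPath_apply, zero_add]

theorem pathSum_of (x : X) (h : PresentedGroup R) : pathSum R φ (of x) h = φ x h := by
  simp [pathSum, crossPath, crossEdge]

theorem pathSum_inv (a : FreeGroup X) (h : PresentedGroup R) :
    pathSum R φ a⁻¹ h = -pathSum R φ a ((PresentedGroup.mk R a)⁻¹ * h) := by
  have := pathSum_mul R φ a a⁻¹ h
  rw [mul_inv_cancel, pathSum_one, map_inv] at this
  linarith

/-- Since `r` is a closed loop in the Cayley graph, the two stems run over the same edges in
opposite directions and cancel. -/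
theorem pathSum_conj {r : FreeGroup X} (hr : PresentedGroup.mk R r = 1) (w : FreeGroup X)
    (h : PresentedGroup R) :
    pathSum R φ (w * r * w⁻¹) h = pathSum R φ r ((PresentedGroup.mk R w)⁻¹ * h) := by
  rw [pathSum_mul, pathSum_mul, pathSum_inv, hr, map_inv, one_mul]
  ring

theorem pathSum_pow {r : FreeGroup X} (hr : PresentedGroup.mk R r = 1) (k : ℕ)
    (h : PresentedGroup R) : pathSum R φ (r ^ k) h = k * pathSum R φ r h := by
  induction k with
  | zero => simp [pathSum_one]
  | succ k ih =>
    rw [pow_succ, pathSum_mul, hr, one_mul, ih]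
    push_cast
    ring

variable {R φ}

theorem abs_pathSum_le [DecidableEq X] (hφ : ∀ x h, |φ x h| ≤ 1) (g : FreeGroup X)
    (h : PresentedGroup R) : |pathSum R φ g h| ≤ g.norm := by
  have key : ∀ w : List (X × Bool), ∀ h, |pathSum R φ (mk w) h| ≤ w.length := by
    intro w
    induction w with
    | nil => simp [← one_eq_mk, pathSum_one]
    | cons e w ih =>
      intro h
      rw [mk_cons, pathSum_mul]
      have h1 : ∀ h', |pathSum R φ (mk [e]) h'| ≤ 1 := by
        intro h'
        obtain ⟨x, _ | _⟩ := e
        · have : mk [(x, false)] = (of x)⁻¹ := rfl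
          rw [this, pathSum_inv, abs_neg, pathSum_of]
          exact hφ _ _
        · have : mk [(x, true)] = of x := rfl
          rw [this, pathSum_of]
          exact hφ _ _
      have := abs_add_le (pathSum R φ (mk w) h)
        (pathSum R φ (mk [e]) (PresentedGroup.mk R (mk w) * h))
      have h2 := ih h
      have h3 := h1 (PresentedGroup.mk R (mk w) * h)
      push_cast [List.length_cons]
      linarith
  have := key g.toWord h
  rwa [mk_toWord] at this

theorem mk_eq_one_of_mem {r : FreeGroup X} (hr : r ∈ R ∨ r⁻¹ ∈ R) :
    PresentedGroup.mk R r = 1 := by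
  rcases hr with h | h
  · exact PresentedGroup.one_of_mem h
  · rw [← inv_eq_one, ← map_inv]
    exact PresentedGroup.one_of_mem h

theorem AreaLE.abs_pathSum_le [DecidableEq X] (hφ : ∀ x h, |φ x h| ≤ 1) {m t : ℕ}
    {g : FreeGroup X} (hg : AreaLE R m g) (ht : ∀ r ∈ R, r.norm ≤ t) (h : PresentedGroup R) :
    |pathSum R φ g h| ≤ t * m := by
  obtain ⟨L, ⟨hL, rfl⟩, hm⟩ := hg
  have key : |pathSum R φ (conjProd L) h| ≤ t * L.length := by
    clear hm
    induction L generalizing h with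
    | nil => simp [conjProd, pathSum_one]
    | cons p L ih =>
      have hp := hL p (by simp)
      have h1 : conjProd (p :: L) = p.1 * p.2 * p.1⁻¹ * conjProd L := by simp [conjProd]
      have h2 := ih h fun q hq => hL q (by simp [hq])
      have h3 := MillerMachine.abs_pathSum_le hφ p.2
        ((PresentedGroup.mk R p.1)⁻¹ * (PresentedGroup.mk R (conjProd L) * h))
      have h4 : p.2.norm ≤ t := by
        rcases hp with hp | hp
        · exact ht _ hp
        · rw [← norm_inv_eq]
          exact ht _ hp
      rw [h1, pathSum_mul, pathSum_conj R φ (mk_eq_one_of_mem hp)]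
      have h5 := abs_add_le (pathSum R φ (conjProd L) h) (pathSum R φ p.2
        ((PresentedGroup.mk R p.1)⁻¹ * (PresentedGroup.mk R (conjProd L) * h)))
      have h6 : (p.2.norm : ℤ) ≤ t := by exact_mod_cast h4
      push_cast [List.length_cons]
      linarith
  have h7 : (t : ℤ) * L.length ≤ t * m := by gcongr
  exact key.trans h7

end EdgePotential

/-! ### Shortest relations and the comparison of length with the Dehn function -/

section ShortestRelation

variable {X : Type*} [DecidableEq X] {R : Set (FreeGroup X)}

/-- A proper nonempty subword of a shortest relation is not a relation. -/
theorem eq_nil_of_shortest {r : FreeGroup X}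
    (hmin : ∀ s, PresentedGroup.mk R s = 1 → s ≠ 1 → r.norm ≤ s.norm)
    {c d y : List (X × Bool)} (hw : r.toWord = c ++ d ++ y)
    (hd : PresentedGroup.mk R (mk (d ++ y)) = PresentedGroup.mk R (mk y)) :
    d = [] ∨ c = [] ∧ y = [] := by
  by_contra! hcon
  obtain ⟨h0, h1⟩ := hcon
  rw [← mul_mk, map_mul, mul_eq_right] at hd
  have hred : IsReduced d := isReduced_toWord.infix ⟨c, y, hw.symm⟩
  have hd1 : mk d ≠ 1 := by
    intro h
    rw [← toWord_eq_nil_iff, toWord_mk, hred.reduce_eq] at h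
    exact h0 h
  have h2 := (hmin _ hd hd1).trans norm_mk_le
  rw [FreeGroup.norm, hw] at h2
  simp only [List.length_append] at h2
  have hc : c = [] := List.length_eq_zero_iff.1 (by omega)
  exact h1 hc (List.length_eq_zero_iff.1 (by omega))

/-- A shortest relation does not cross an edge of the Cayley graph in both directions. -/
theorem not_both_directions {r : FreeGroup X} (hr : PresentedGroup.mk R r = 1)
    (hmin : ∀ s, PresentedGroup.mk R s = 1 → s ≠ 1 → r.norm ≤ s.norm)
    {x : X} {u v u' v' : List (X × Bool)} (h : r.toWord = u ++ (x, false) :: v)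
    (h' : r.toWord = u' ++ (x, true) :: v') :
    PresentedGroup.mk R (mk ((x, false) :: v)) ≠ PresentedGroup.mk R (mk v') := by
  intro heq
  have hred : IsReduced r.toWord := isReduced_toWord
  -- Equality would place `x` directly before `x⁻¹` in a reduced word.
  have hne : (x, false) :: v ≠ v' := by
    rintro rfl
    have := hred.infix (L₁ := (x, true) :: (x, false) :: v) ⟨u', [], by simp [h']⟩
    simpa using (isReduced_cons_cons.1 this).1 rfl
  rcases List.suffix_or_suffix_of_suffix (l₁ := (x, false) :: v) (l₂ := v') (l₃ := r.toWord)
    ⟨u, h.symm⟩ ⟨u' ++ [(x, true)], by simp [h']⟩ with ⟨d, hd⟩ | ⟨d, hd⟩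
  · obtain rfl | ⟨-, h2⟩ := eq_nil_of_shortest hmin (c := u' ++ [(x, true)]) (d := d)
      (y := (x, false) :: v) (by simp [h', ← hd]) (by rw [hd, heq])
    · exact hne (by simpa using hd)
    · simp at h2
  · obtain rfl | ⟨rfl, rfl⟩ := eq_nil_of_shortest hmin (c := u) (d := d)
      (y := v') (by simp [h, ← hd]) (by rw [hd, heq])
    · exact hne (by simpa using hd.symm)
    · rcases u' with _ | ⟨e, u'⟩
      · rw [h] at h'
        simp at h'
      · rw [h] at h'
        simp only [List.nil_append, List.cons_append, List.cons.injEq] at h'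
        obtain ⟨rfl, rfl⟩ := h'
        have hconj : r = (of x)⁻¹ * mk u' * of x := by
          rw [← mk_toWord (x := r), h, List.nil_append, mk_cons, ← mul_mk, mul_assoc]
          rfl
        have h3 : PresentedGroup.mk R (mk u') = 1 := by
          rw [hconj, map_mul, map_mul, map_inv] at hr
          have := congrArg (fun z => PresentedGroup.mk R (of x) * z *
            (PresentedGroup.mk R (of x))⁻¹) hr
          simpa [mul_assoc] using this
        have h4 : mk u' ≠ 1 := by
          intro h4
          rw [h4] at hconj
          have : r.toWord = [] := by simp [hconj]
          simp [h] at this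
        have h5 := (hmin _ h3 h4).trans norm_mk_le
        rw [FreeGroup.norm, h] at h5
        simp at h5

/-- Some potential with values `±1` is `1` along every edge of the loop of a shortest relation. -/
theorem exists_potential {r : FreeGroup X} (hr : PresentedGroup.mk R r = 1)
    (hmin : ∀ s, PresentedGroup.mk R s = 1 → s ≠ 1 → r.norm ≤ s.norm) :
    ∃ φ : X → PresentedGroup R → ℤ, (∀ x h, |φ x h| ≤ 1) ∧ pathSum R φ r 1 = r.norm := by
  classical
  -- An edge that the loop crosses backwards is not crossed forwards, so it gets the default `-1`
  -- and contributes `+1`.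
  let φ : X → PresentedGroup R → ℤ := fun x h =>
    if ∃ u v, r.toWord = u ++ (x, true) :: v ∧ h = PresentedGroup.mk R (mk v) then 1 else -1
  have key : ∀ v u, r.toWord = u ++ v → pathSum R φ (mk v) 1 = v.length := by
    intro v
    induction v with
    | nil => simp [← one_eq_mk, pathSum_one]
    | cons e v ih =>
      intro u hu
      rw [mk_cons, pathSum_mul, ih (u ++ [e]) (by simp [hu]), mul_one]
      have h1 : pathSum R φ (mk [e]) (PresentedGroup.mk R (mk v)) = 1 := by
        obtain ⟨x, _ | _⟩ := e
        · have h2 : mk [(x, false)] = (of x)⁻¹ := rfl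
          rw [h2, pathSum_inv, pathSum_of, neg_eq_iff_eq_neg]
          refine if_neg ?_
          rintro ⟨u', v', hu', hv'⟩
          refine not_both_directions hr hmin hu hu' ?_
          rw [mk_cons, h2, map_mul, map_inv, hv']
        · have h2 : mk [(x, true)] = of x := rfl
          rw [h2, pathSum_of]
          exact if_pos ⟨u, v, hu, rfl⟩
      rw [h1]
      simp
  refine ⟨φ, fun x h => ?_, ?_⟩
  · simp only [φ]
    split_ifs <;> simp
  · have := key r.toWord [] rfl
    rwa [mk_toWord] at this

theorem norm_pow_le (g : FreeGroup X) (k : ℕ) : (g ^ k).norm ≤ k * g.norm := by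
  induction k with
  | zero => simp
  | succ k ih =>
    rw [pow_succ, add_mul, one_mul]
    exact (FreeGroup.norm_mul_le _ _).trans (by omega)

/-- If some nontrivial relation has length at most `n`, then `n` is less than `2 t` times the
Dehn function. -/
theorem succ_le_two_mul_dehn [Finite X] {t n : ℕ} (ht : ∀ r ∈ R, r.norm ≤ t) {g : FreeGroup X}
    (hg : g ∈ nullBall R n) (hg1 : g ≠ 1) : n + 1 ≤ 2 * (t * dehn R n) := by
  classical
  have hex : ∃ l, ∃ s : FreeGroup X, PresentedGroup.mk R s = 1 ∧ s ≠ 1 ∧ s.norm = l :=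
    ⟨_, g, hg.2, hg1, rfl⟩
  obtain ⟨r, hr, hr1, hrl⟩ := Nat.find_spec hex
  have hmin : ∀ s, PresentedGroup.mk R s = 1 → s ≠ 1 → r.norm ≤ s.norm := fun s hs hs1 => by
    rw [hrl]
    exact Nat.find_min' hex ⟨s, hs, hs1, rfl⟩
  obtain ⟨φ, hφ, hsum⟩ := exists_potential hr hmin
  have hpos : 0 < r.norm := Nat.pos_of_ne_zero (by simpa using hr1)
  have hrn : r.norm ≤ n := (hmin g hg.2 hg1).trans hg.1
  set k := n / r.norm with hk
  have hk1 : 1 ≤ k := (Nat.one_le_div_iff hpos).2 hrn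
  have hkn : k * r.norm ≤ n := Nat.div_mul_le_self n r.norm
  have hnk : n < (k + 1) * r.norm := by
    rw [mul_comm]
    exact Nat.lt_mul_div_succ n hpos
  have hball : r ^ k ∈ nullBall R n := ⟨(norm_pow_le r k).trans hkn, by rw [map_pow, hr, one_pow]⟩
  have harea : area R (r ^ k) ≤ dehn R n := (isGreatest_dehn R n).2 ⟨_, hball, rfl⟩
  have h1 := ((areaLE_area hball.2).mono harea).abs_pathSum_le hφ ht 1
  rw [pathSum_pow R φ hr, hsum] at h1
  have h2 : k * r.norm ≤ t * dehn R n := by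
    have := (le_abs_self _).trans h1
    exact_mod_cast this
  nlinarith

theorem dehn_le_Lam [Finite X] (R : Set (FreeGroup X)) (n : ℕ) : dehn R n ≤ Lam R n := by
  obtain ⟨g, hg, hgd⟩ := (isGreatest_dehn R n).1
  rw [← hgd]
  exact (area_le_lam hg.2).trans ((isGreatest_Lam R n).2 ⟨g, hg, rfl⟩)

theorem Lam_le [Finite X] (R : Finset (FreeGroup X)) (n : ℕ) :
    Lam (R : Set (FreeGroup X)) n ≤
      3 * maxRelatorLength R * dehn (R : Set (FreeGroup X)) n ^ 2 := by
  obtain ⟨g, hg, hgl⟩ := (isGreatest_Lam (R : Set (FreeGroup X)) n).1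
  have ht : ∀ r ∈ (R : Set (FreeGroup X)), r.norm ≤ maxRelatorLength R := fun r hr =>
    (Finset.le_sup (f := FreeGroup.norm) hr).trans (le_max_left _ _)
  rw [← hgl]
  by_cases hg1 : g = 1
  · have h0 := lam_le_of_area_le (areaLE_one (R : Set (FreeGroup X)) 0) ht le_rfl
    rw [hg1]
    simp at h0
    simp [h0]
  · have harea : area (R : Set (FreeGroup X)) g ≤ dehn (R : Set (FreeGroup X)) n :=
      (isGreatest_dehn _ n).2 ⟨g, hg, rfl⟩
    have h1 := lam_le_of_area_le ((areaLE_area hg.2).mono harea) ht hg.1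
    have h2 := succ_le_two_mul_dehn ht hg hg1
    generalize dehn (R : Set (FreeGroup X)) n = D at *
    generalize maxRelatorLength R = t at *
    have h3 : D ≤ D ^ 2 := Nat.le_self_pow (by norm_num) D
    have h4 : 2 * D * (n + 1) ≤ 2 * D * (2 * (t * D)) := Nat.mul_le_mul_left _ h2
    have h5 : t * D ≤ t * D ^ 2 := Nat.mul_le_mul_left _ h3
    nlinarith

end ShortestRelation

end MillerMachine

theorem mainTheorem5 {X : Type*} [Finite X] [DecidableEq X] (R : Finset (FreeGroup X)) (n : ℕ) :
    MillerMachine.dehn (R : Set (FreeGroup X)) n ≤ MillerMachine.Lam (R : Set (FreeGroup X)) n ∧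
      MillerMachine.Lam (R : Set (FreeGroup X)) n ≤
        3 * MillerMachine.maxRelatorLength R * MillerMachine.dehn (R : Set (FreeGroup X)) n ^ 2 :=
  ⟨MillerMachine.dehn_le_Lam _ n, MillerMachine.Lam_le R n⟩
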